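/- Let $\mathcal{C}$ be a category. Its pro-category $\textup{pro-}\mathcal{C}$ has as objects the functors $X : I \to \mathcal{C}$, $s \mapsto X_s$, where $I$ is a small cofiltered category (in particular $I$ is non-empty), and as morphisms $$\mathrm{Hom}_{\textup{pro-}\mathcal{C}}(X,Y) = \lim_{s} \operatorname{colim}_{t} \mathrm{Hom}_{\mathcal{C}}(X_t, Y_s)$$ with the natural composition. A natural transformation $\eta : \tilde X \to \tilde Y$ between functors $\tilde X, \tilde Y : I \to \mathcal{C}$ on one small cofiltered category $I$ represents a map $\tilde X \to \tilde Y$ of $\textup{pro-}\mathcal{C}$, whose component at $s$ is the class of $\eta_s : \tilde X_s \to \tilde Y_s$. A level representation of a map $f : X \to Y$ of $\textup{pro-}\mathcal{C}$ consists of such an $I$, such an $\eta : \tilde X \to \tilde Y$, and isomorphisms $X \cong \tilde X$ and $Y \cong \tilde Y$ in $\textup{pro-}\mathcal{C}$ such that the square formed by these isomorphisms, $f$ and the map represented by $\eta$ commutes. For a class $C$ of maps of $\mathcal{C}$, a map of $\textup{pro-}\mathcal{C}$ is essentially of type $C$ if it has a level representation $\eta$ with $\eta_s \in C$ for every $s \in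 I$. **Corollary.** Let $C$ be any class of maps of a category $\mathcal{C}$. The class of maps of $\textup{pro-}\mathcal{C}$ that are essentially of type $C$ is closed under retracts: if a map $g$ of $\textup{pro-}\mathcal{C}$ is essentially of type $C$ and a map $f$ is a retract of $g$ in the category of arrows of $\textup{pro-}\mathcal{C}$ (objects the maps, morphisms the commutative squares), then $f$ is essentially of type $C$. -/

import Mathlib

open CategoryTheory

universe w v u

/-- A pro-object of `C`: a diagram in `C` indexed by a small cofiltered category. -/
structure ProObj (C : Type u) [Category.{v} C] where
  /-- the index category -/
  Index : Type w
  [smallCategory : SmallCategory Index]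
  [isCofiltered : IsCofiltered Index]
  /-- the diagram -/
  diagram : Index ⥤ C

namespace ProObj

attribute [instance] ProObj.smallCategory ProObj.isCofiltered

variable {C : Type u} [Category.{v} C]

/-- The set `colim_t Hom(X_t, c)`, for a pro-object `X` and an object `c` of `C`. -/
def Germ (X : ProObj.{w} C) (c : C) : Type (max w v) :=
  (X.diagram.op ⋙ yoneda.obj c).ColimitType

namespace Germ

/-- The class in `colim_t Hom(X_t, c)` of a map `X_t ⟶ c`. -/
def mk (X : ProObj.{w} C) {c : C} (t : X.Index) (a : X.diagram.obj t ⟶ c) : X.Germ c :=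
  (X.diagram.op ⋙ yoneda.obj c).ιColimitType (Opposite.op t) a

lemma ind {X : ProObj.{w} C} {c : C} {p : X.Germ c → Prop}
    (h : ∀ (t : X.Index) (a : X.diagram.obj t ⟶ c), p (mk X t a)) (x : X.Germ c) : p x := by
  obtain ⟨⟨t, a⟩⟩ := x
  exact h t.unop a

lemma mk_map_comp (X : ProObj.{w} C) {c : C} {t t' : X.Index} (q : t' ⟶ t)
    (a : X.diagram.obj t ⟶ c) : mk X t' (X.diagram.map q ≫ a) = mk X t a :=
  (X.diagram.op ⋙ yoneda.obj c).ιColimitType_map q.op a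

/-- Descent of a compatible family of functions to the colimit. -/
def lift {X : ProObj.{w} C} {c : C} {T : Type*}
    (φ : ∀ t : X.Index, (X.diagram.obj t ⟶ c) → T)
    (hφ : ∀ ⦃t t' : X.Index⦄ (q : t' ⟶ t) (a : X.diagram.obj t ⟶ c),
      φ t' (X.diagram.map q ≫ a) = φ t a) : X.Germ c → T :=
  Quot.lift (fun p => φ p.1.unop p.2) (by
    rintro ⟨t, a⟩ ⟨t', a'⟩ ⟨q, hq⟩
    have h : a' = X.diagram.map q.unop ≫ a := hq
    exact (hφ q.unop a).symm.trans (congrArg (φ t'.unop) h.symm))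

@[simp]
lemma lift_mk {X : ProObj.{w} C} {c : C} {T : Type*}
    (φ : ∀ t : X.Index, (X.diagram.obj t ⟶ c) → T)
    (hφ : ∀ ⦃t t' : X.Index⦄ (q : t' ⟶ t) (a : X.diagram.obj t ⟶ c),
      φ t' (X.diagram.map q ≫ a) = φ t a) (t : X.Index) (a : X.diagram.obj t ⟶ c) :
    lift φ hφ (mk X t a) = φ t a := rfl

/-- The map `colim_t Hom(X_t, c) → colim_t Hom(X_t, d)` given by composition with `b : c ⟶ d`. -/
def map {X : ProObj.{w} C} {c d : C} (b : c ⟶ d) : X.Germ c → X.Germ d :=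
  lift (fun t a => mk X t (a ≫ b)) (fun t t' q a => by
    rw [Category.assoc, mk_map_comp])

@[simp]
lemma map_mk {X : ProObj.{w} C} {c d : C} (b : c ⟶ d) (t : X.Index)
    (a : X.diagram.obj t ⟶ c) : map b (mk X t a) = mk X t (a ≫ b) := rfl

lemma map_map {X : ProObj.{w} C} {c d e : C} (b : c ⟶ d) (b' : d ⟶ e) (x : X.Germ c) :
    map b' (map b x) = map (b ≫ b') x := by
  induction x using Germ.ind with
  | h t a => simp

end Germ

/-- The set `lim_s colim_t Hom(X_t, Y_s)` of maps of pro-objects from `X` to `Y`. -/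
@[ext]
structure Hom (X Y : ProObj.{w} C) where
  /-- the component in `colim_t Hom(X_t, Y_s)` -/
  app (s : Y.Index) : X.Germ (Y.diagram.obj s)
  map_app {s s' : Y.Index} (p : s ⟶ s') : Germ.map (Y.diagram.map p) (app s) = app s'

attribute [simp] Hom.map_app

namespace Hom

/-- Composition of a map `f : X → Y` of pro-objects with an element of `colim_s Hom(Y_s, c)`:
the class of `b : Y_s ⟶ c` is sent to the image under `b` of the `s`-component of `f`. -/
def bind {X Y : ProObj.{w} C} (f : Hom X Y) {c : C} : Y.Germ c → X.Germ c :=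
  Germ.lift (fun s b => Germ.map b (f.app s)) (fun s s' q b => by
    rw [← Germ.map_map, f.map_app])

@[simp]
lemma bind_mk {X Y : ProObj.{w} C} (f : Hom X Y) {c : C} (s : Y.Index)
    (b : Y.diagram.obj s ⟶ c) : f.bind (Germ.mk Y s b) = Germ.map b (f.app s) := rfl

lemma map_bind {X Y : ProObj.{w} C} (f : Hom X Y) {c d : C} (b : c ⟶ d) (y : Y.Germ c) :
    Germ.map b (f.bind y) = f.bind (Germ.map b y) := by
  induction y using Germ.ind with
  | h t a => simp [Germ.map_map]

/-- The identity, represented by the identities `X_s ⟶ X_s`. -/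
def id (X : ProObj.{w} C) : Hom X X where
  app s := Germ.mk X s (𝟙 _)
  map_app {s s'} p := by
    rw [Germ.map_mk, Category.id_comp, ← Germ.mk_map_comp X p, Category.comp_id]

/-- Composition of maps of pro-objects. -/
def comp {X Y Z : ProObj.{w} C} (f : Hom X Y) (g : Hom Y Z) : Hom X Z where
  app r := f.bind (g.app r)
  map_app p := by rw [map_bind, g.map_app]

lemma id_bind {X : ProObj.{w} C} {c : C} (x : X.Germ c) : (id X).bind x = x := by
  induction x using Germ.ind with
  | h t a => simp [id]

lemma comp_bind {X Y Z : ProObj.{w} C} (f : Hom X Y) (g : Hom Y Z) {c : C} (z : Z.Germ c) :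
    (comp f g).bind z = f.bind (g.bind z) := by
  induction z using Germ.ind with
  | h t a => simp [comp, map_bind]

end Hom

/-- The category `pro-C`. -/
instance : Category.{max w v} (ProObj.{w} C) where
  Hom := Hom
  id := Hom.id
  comp := Hom.comp
  id_comp f := Hom.ext (funext fun s => Hom.id_bind (f.app s))
  comp_id {X Y} f := Hom.ext (funext fun s => by
    change Germ.map (𝟙 _) (f.app s) = f.app s
    rw [← Y.diagram.map_id, f.map_app])
  assoc f g h := Hom.ext (funext fun s => Hom.comp_bind f g (h.app s))

/-- The pro-object given by a diagram indexed by a small cofiltered category. -/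
abbrev of {I : Type w} [SmallCategory I] [IsCofiltered I] (F : I ⥤ C) : ProObj.{w} C where
  Index := I
  diagram := F

/-- The map of pro-objects represented by a natural transformation `η : F ⟶ G` of diagrams:
its component at `s` is the class of `η_s : F_s ⟶ G_s`. -/
def levelMap {I : Type w} [SmallCategory I] [IsCofiltered I] {F G : I ⥤ C} (η : F ⟶ G) :
    of F ⟶ of G :=
  Hom.mk (X := of F) (Y := of G) (fun s : I => Germ.mk (of F) s (η.app s)) (fun {s s' : I} p =>
    (congrArg (Germ.mk (of F) s) (η.naturality p).symm).trans
      (Germ.mk_map_comp (of F) p (η.app s')))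

/-- A level representation of a map `f : X ⟶ Y` of pro-objects: a natural transformation of
diagrams over a common small cofiltered index category, with isomorphisms from `X` and `Y` to the
corresponding pro-objects that identify `f` with the map it represents. -/
structure LevelRepresentation {X Y : ProObj.{w} C} (f : X ⟶ Y) where
  /-- the index category -/
  Index : Type w
  [smallCategory : SmallCategory Index]
  [isCofiltered : IsCofiltered Index]
  /-- the diagram replacing `X` -/
  source : Index ⥤ C
  /-- the diagram replacing `Y` -/
  target : Index ⥤ C
  /-- the levelwise maps -/
  η : source ⟶ target
  /-- the isomorphism at the source -/
  isoSource : X ≅ of source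
  /-- the isomorphism at the target -/
  isoTarget : Y ≅ of target
  comm : f ≫ isoTarget.hom = isoSource.hom ≫ levelMap η

attribute [instance] LevelRepresentation.smallCategory LevelRepresentation.isCofiltered

/-- A level representation is of type `P` if each of its levelwise maps belongs to `P`. -/
def LevelRepresentation.IsOfType {X Y : ProObj.{w} C} {f : X ⟶ Y} (R : LevelRepresentation f)
    (P : MorphismProperty C) : Prop :=
  ∀ s : R.Index, P (R.η.app s)

/-- The class of maps of `pro-C` that are essentially of type `P`, i.e., that have a level
representation of type `P`. -/
def essentially (P : MorphismProperty C) : MorphismProperty (ProObj.{w} C) :=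
  fun _ _ f => ∃ R : LevelRepresentation f, R.IsOfType P

end ProObj

/-! A level representation of `g` is a pro-object `A` of `Arrow C`, and the passage from pro-objects
of `Arrow C` to arrows of pro-objects is fully faithful (`hom_arrow_ext`, `exists_hom_arrow`). So
the idempotent of `g` given by the retract lifts to an idempotent `ε` of `A`. It remains to split
`ε` without leaving the objects `A_i`, so that the levelwise maps stay in the class
(`exists_splitting`). Choose representatives `a_i : A_{t i} ⟶ A_i` of the components of `ε` and
enlarge the index category by arrows `t i ⟶ i` acting as `a_i`. Idempotency makes the result
cofiltered (`Adjoined.isCofiltered`), and the enlarged diagram splits `ε`. Its source and target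
split the idempotents on those of `g` that `f` also splits, hence it represents `f`. -/

namespace ProObj

/-! ### Equality of germs -/

section Germ

variable {C : Type u} [Category.{v} C]

lemma Germ.mk_eq_mk_iff (X : ProObj.{w} C) {c : C} {s t : X.Index}
    (a : X.diagram.obj s ⟶ c) (b : X.diagram.obj t ⟶ c) :
    Germ.mk X s a = Germ.mk X t b ↔ ∃ (r : X.Index) (p : r ⟶ s) (q : r ⟶ t),
      X.diagram.map p ≫ a = X.diagram.map q ≫ b := by
  refine (Functor.ιColimitType_eq_iff_of_isFiltered
    (F := X.diagram.op ⋙ yoneda.obj c) (j := Opposite.op s) (j' := Opposite.op t) a b).trans ?_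
  constructor
  · rintro ⟨r, p, q, h⟩
    exact ⟨r.unop, p.unop, q.unop, h⟩
  · rintro ⟨r, p, q, h⟩
    exact ⟨Opposite.op r, p.op, q.op, h⟩

lemma Germ.mk_eq_mk_iff_of_same (X : ProObj.{w} C) {c : C} {s : X.Index}
    (a b : X.diagram.obj s ⟶ c) :
    Germ.mk X s a = Germ.mk X s b ↔ ∃ (r : X.Index) (p : r ⟶ s),
      X.diagram.map p ≫ a = X.diagram.map p ≫ b := by
  refine (Functor.ιColimitType_eq_iff_of_isFiltered'
    (F := X.diagram.op ⋙ yoneda.obj c) (j := Opposite.op s) a b).trans ?_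
  constructor
  · rintro ⟨r, p, h⟩
    exact ⟨r.unop, p.unop, h⟩
  · rintro ⟨r, p, h⟩
    exact ⟨Opposite.op r, p.op, h⟩

lemma Germ.exists_rep {X : ProObj.{w} C} {c : C} (x : X.Germ c) :
    ∃ (t : X.Index) (a : X.diagram.obj t ⟶ c), Germ.mk X t a = x := by
  induction x using Germ.ind with
  | h t a => exact ⟨t, a, rfl⟩

lemma hom_ext {X Y : ProObj.{w} C} {f g : X ⟶ Y}
    (h : ∀ s, Hom.app f s = Hom.app g s) : f = g :=
  Hom.ext (funext h)

lemma app_congr {X Y : ProObj.{w} C} {f g : X ⟶ Y} (h : f = g) (s : Y.Index) :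
    Hom.app f s = Hom.app g s := by rw [h]

lemma comp_app {X Y Z : ProObj.{w} C} (f : X ⟶ Y) (g : Y ⟶ Z) (s : Z.Index) :
    Hom.app (f ≫ g) s = Hom.bind f (Hom.app g s) := rfl

end Germ

/-! ### Levelwise functors and transformations -/

section Functoriality

universe v' u'

variable {D : Type u'} [Category.{v'} D] {C : Type u} [Category.{v} C]

/-- The pro-object obtained by applying a functor levelwise. -/
abbrev mapObj (Φ : D ⥤ C) (X : ProObj.{w} D) : ProObj.{w} C where
  Index := X.Index
  diagram := X.diagram ⋙ Φ

/-- The map induced by a functor on germs. -/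
def Germ.mapFunctor (Φ : D ⥤ C) {X : ProObj.{w} D} {d : D} :
    X.Germ d → (mapObj Φ X).Germ (Φ.obj d) :=
  Germ.lift (fun t a => Germ.mk (mapObj Φ X) t (Φ.map a)) (fun t t' q a => by
    rw [Φ.map_comp]
    exact Germ.mk_map_comp (mapObj Φ X) q (Φ.map a))

lemma Germ.mapFunctor_mk (Φ : D ⥤ C) (X : ProObj.{w} D) {d : D} (t : X.Index)
    (a : X.diagram.obj t ⟶ d) :
    Germ.mapFunctor Φ (Germ.mk X t a) = Germ.mk (mapObj Φ X) t (Φ.map a) := rfl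

lemma Germ.mapFunctor_map (Φ : D ⥤ C) {X : ProObj.{w} D} {d d' : D} (b : d ⟶ d')
    (x : X.Germ d) :
    Germ.mapFunctor Φ (Germ.map b x) = Germ.map (Φ.map b) (Germ.mapFunctor Φ x) := by
  induction x using Germ.ind with
  | h t a => simp [Germ.mapFunctor_mk]

/-- The functor on pro-categories induced by a functor. -/
def mapFunctor (Φ : D ⥤ C) : ProObj.{w} D ⥤ ProObj.{w} C where
  obj X := mapObj Φ X
  map {X Y} f := Hom.mk (X := mapObj Φ X) (Y := mapObj Φ Y)
    (fun s => Germ.mapFunctor Φ (Hom.app f s)) (fun p => by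
      change Germ.map (Φ.map _) _ = _
      rw [← Germ.mapFunctor_map, Hom.map_app])
  map_id X := hom_ext fun s => by
    change Germ.mk _ s (Φ.map (𝟙 _)) = Germ.mk _ s (𝟙 _)
    rw [Φ.map_id]
    rfl
  map_comp {X Y Z} f g := hom_ext fun s => by
    change Germ.mapFunctor Φ (Hom.bind f (Hom.app g s)) =
      Hom.bind _ (Germ.mapFunctor Φ (Hom.app g s))
    induction Hom.app g s using Germ.ind with
    | h t a => exact Germ.mapFunctor_map Φ a _

/-- The natural transformation of functors of pro-categories induced by a natural
transformation. -/
def mapNatTrans {Φ Ψ : D ⥤ C} (α : Φ ⟶ Ψ) :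
    mapFunctor.{w} Φ ⟶ mapFunctor.{w} Ψ where
  app X := levelMap (Functor.whiskerLeft X.diagram α)
  naturality X Y f := hom_ext fun s => by
    change Germ.map (α.app _) (Germ.mapFunctor Φ (Hom.app f s)) =
      Hom.bind (levelMap (Functor.whiskerLeft X.diagram α)) (Germ.mapFunctor Ψ (Hom.app f s))
    induction Hom.app f s using Germ.ind with
    | h t a => exact congrArg (Germ.mk (mapObj Φ X) t) (α.naturality a)

end Functoriality

/-! ### Full faithfulness of pro-arrows in arrows of pro-objects -/

section Arrow

variable {C : Type u} [Category.{v} C]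

lemma Germ.arrow_ext {X : ProObj.{w} (Arrow C)} {d : Arrow C} {x y : X.Germ d}
    (hl : Germ.mapFunctor Arrow.leftFunc x = Germ.mapFunctor Arrow.leftFunc y)
    (hr : Germ.mapFunctor Arrow.rightFunc x = Germ.mapFunctor Arrow.rightFunc y) : x = y := by
  obtain ⟨s, a, rfl⟩ := x.exists_rep
  obtain ⟨t, b, rfl⟩ := y.exists_rep
  obtain ⟨r, p, q, h⟩ := (Germ.mk_eq_mk_iff (mapObj Arrow.leftFunc X) _ _).1 hl
  obtain ⟨r', p', q', h'⟩ := (Germ.mk_eq_mk_iff (mapObj Arrow.rightFunc X) _ _).1 hr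
  -- The two components become equal at different stages `r` and `r'`; `k` refines both compatibly
  -- with the maps to `s` and `t`.
  obtain ⟨k, m, m', hp, hq⟩ := IsCofiltered.bowtie p p' q q'
  refine (Germ.mk_eq_mk_iff X _ _).2 ⟨k, m ≫ p, m ≫ q, ?_⟩
  ext
  · have : (X.diagram.map m).left ≫ (X.diagram.map p ≫ a).left =
        (X.diagram.map m).left ≫ (X.diagram.map q ≫ b).left :=
      congrArg ((X.diagram.map m).left ≫ ·) h
    simpa using this
  · have : (X.diagram.map m').right ≫ (X.diagram.map p' ≫ a).right =
        (X.diagram.map m').right ≫ (X.diagram.map q' ≫ b).right :=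
      congrArg ((X.diagram.map m').right ≫ ·) h'
    rw [hp, hq]
    simpa using this

lemma hom_arrow_ext {X Y : ProObj.{w} (Arrow C)} {f g : X ⟶ Y}
    (hl : (mapFunctor Arrow.leftFunc).map f = (mapFunctor Arrow.leftFunc).map g)
    (hr : (mapFunctor Arrow.rightFunc).map f = (mapFunctor Arrow.rightFunc).map g) : f = g :=
  hom_ext fun s => Germ.arrow_ext (app_congr hl s) (app_congr hr s)

lemma Germ.exists_arrow {X : ProObj.{w} (Arrow C)} {d : Arrow C}
    (x : (mapObj Arrow.leftFunc X).Germ d.left) (y : (mapObj Arrow.rightFunc X).Germ d.right)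
    (h : Germ.map d.hom x = Hom.bind ((mapNatTrans Arrow.leftToRight).app X) y) :
    ∃ z : X.Germ d, Germ.mapFunctor Arrow.leftFunc z = x ∧
      Germ.mapFunctor Arrow.rightFunc z = y := by
  obtain ⟨s, a, rfl⟩ := x.exists_rep
  obtain ⟨t, b, rfl⟩ := y.exists_rep
  have h' : Germ.mk (mapObj Arrow.leftFunc X) s (a ≫ d.hom) =
    Germ.mk (mapObj Arrow.leftFunc X) t ((X.diagram.obj t).hom ≫ b) := h
  obtain ⟨r, p, q, e⟩ := (Germ.mk_eq_mk_iff _ _ _).1 h'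
  -- Restricted to the common stage `r`, the two representatives form a commutative square: this is
  -- `e`.
  refine ⟨Germ.mk X r (Arrow.homMk ((X.diagram.map p).left ≫ a)
    ((X.diagram.map q).right ≫ b) ?_), ?_, ?_⟩
  · exact (Category.assoc _ _ _).trans (e.trans
      (Arrow.w_assoc (X.diagram.map q) b))
  · exact Germ.mk_map_comp (mapObj Arrow.leftFunc X) p a
  · exact Germ.mk_map_comp (mapObj Arrow.rightFunc X) q b

lemma exists_hom_arrow {X Y : ProObj.{w} (Arrow C)}
    (f : (mapFunctor Arrow.leftFunc).obj X ⟶ (mapFunctor Arrow.leftFunc).obj Y)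
    (g : (mapFunctor Arrow.rightFunc).obj X ⟶ (mapFunctor Arrow.rightFunc).obj Y)
    (h : f ≫ (mapNatTrans Arrow.leftToRight).app Y =
      (mapNatTrans Arrow.leftToRight).app X ≫ g) :
    ∃ φ : X ⟶ Y, (mapFunctor Arrow.leftFunc).map φ = f ∧
      (mapFunctor Arrow.rightFunc).map φ = g := by
  choose z hl hr using fun s : Y.Index => Germ.exists_arrow (d := Y.diagram.obj s)
    (Hom.app f s) (Hom.app g s) (app_congr h s)
  refine ⟨Hom.mk z (fun {s s'} p => Germ.arrow_ext ?_ ?_), hom_ext hl, hom_ext hr⟩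
  · rw [Germ.mapFunctor_map, hl, hl]
    exact Hom.map_app f p
  · rw [Germ.mapFunctor_map, hr, hr]
    exact Hom.map_app g p

end Arrow

/-! ### Splitting idempotents by enlarging the index category -/

section Idempotent

universe v' u'

variable {D : Type u'} [Category.{v'} D] {I : Type w} [SmallCategory I]

/-- The arrows of a category `I`, together with an additional arrow `t i ⟶ i` for each `i`. -/
inductive AdjoinedHom (t : I → I) : I → I → Type w
  | map {i j : I} (p : i ⟶ j) : AdjoinedHom t i j
  | step (i : I) : AdjoinedHom t (t i) i

/-- The objects of `I`, as the vertices of the quiver with arrows `AdjoinedHom t`. -/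
def AdjoinedQuiver (_ : I → I) : Type w := I

instance (t : I → I) : Quiver.{w} (AdjoinedQuiver t) where
  Hom i j := AdjoinedHom t i j

/-- The diagram of shape `AdjoinedQuiver t` given by a functor `A` on `I` and maps
`A (t i) ⟶ A i`. -/
def adjoinedPrefunctor (A : I ⥤ D) {t : I → I} (a : ∀ i, A.obj (t i) ⟶ A.obj i) :
    AdjoinedQuiver t ⥤q D where
  obj i := A.obj i
  map := fun
    | .map p => A.map p
    | .step i => a i

/-- The category generated by `I` and the maps `a i`, where two maps are identified if they have
the same value in `D`. -/
abbrev Adjoined (A : I ⥤ D) {t : I → I} (a : ∀ i, A.obj (t i) ⟶ A.obj i) : Type w :=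
  CategoryTheory.Quotient (Paths.lift (adjoinedPrefunctor A a)).homRel

namespace Adjoined

variable (A : I ⥤ D) {t : I → I} (a : ∀ i, A.obj (t i) ⟶ A.obj i)

instance : SmallCategory (Adjoined A a) := CategoryTheory.Quotient.category _

/-- The tautological diagram. -/
def diagram : Adjoined A a ⥤ D :=
  CategoryTheory.Quotient.lift _ (Paths.lift (adjoinedPrefunctor A a)) (fun _ _ _ _ h => h)

/-- The object of `Adjoined A a` given by an object of `I`. -/
def mk (i : I) : Adjoined A a := ⟨i⟩

variable {A} in
/-- The underlying object of `I`. -/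
def val (j : Adjoined A a) : I := j.as

lemma diagram_obj (j : Adjoined A a) : (diagram A a).obj j = A.obj (val a j) := rfl

/-- This is the purpose of the quotient: equations between index arrows can be checked in `D`. -/
lemma diagram_map_injective {i j : Adjoined A a} {f g : i ⟶ j}
    (h : (diagram A a).map f = (diagram A a).map g) : f = g := by
  induction f using Quot.ind
  induction g using Quot.ind
  exact CategoryTheory.Quotient.sound _ h

/-- The map of `Adjoined A a` given by a map of `I`. -/
def mkMap {i j : I} (p : i ⟶ j) : mk A a i ⟶ mk A a j :=
  (CategoryTheory.Quotient.functor _).map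
    (Quiver.Hom.toPath (V := AdjoinedQuiver t) (AdjoinedHom.map p))

/-- The adjoined map. -/
def step (i : I) : mk A a (t i) ⟶ mk A a i :=
  (CategoryTheory.Quotient.functor _).map
    (Quiver.Hom.toPath (V := AdjoinedQuiver t) (AdjoinedHom.step i))

lemma diagram_mkMap {i j : I} (p : i ⟶ j) : (diagram A a).map (mkMap A a p) = A.map p :=
  Category.id_comp (A.map p)

lemma diagram_step (i : I) : (diagram A a).map (step A a i) = a i :=
  Category.id_comp (a i)

lemma diagram_mkMap_step {i j : I} (p : i ⟶ t j) :
    (diagram A a).map (mkMap A a p ≫ step A a j) = A.map p ≫ a j := by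
  refine (Functor.map_comp _ _ _).trans ?_
  exact congrArg₂ (· ≫ ·) (diagram_mkMap A a p) (diagram_step A a j)

variable [IsCofiltered I] (ε : of A ⟶ of A)
  (hε : ε ≫ ε = ε) (ha : ∀ i : I, Germ.mk (of A) (t i) (a i) = Hom.app ε i)

include hε ha

lemma map_step_app (i : I) :
    Germ.map (a i) (Hom.app ε (t i)) = Hom.app ε i := by
  have h := congrArg (fun f => Hom.app f i) hε
  dsimp only at h
  rw [comp_app, ← ha i] at h
  rw [← ha i]
  exact h

lemma map_adjoinedPrefunctor_app {i j : I} (e : AdjoinedHom t i j) :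
    Germ.map ((adjoinedPrefunctor A a).map e : A.obj i ⟶ A.obj j)
      (Hom.app ε i : (of A).Germ (A.obj i)) = Hom.app ε j := by
  cases e with
  | map p => exact Hom.map_app ε p
  | step i => exact map_step_app A a ε hε ha _

lemma map_path_app {i j : I} (f : Quiver.Path (V := AdjoinedQuiver t) i j) :
    Germ.map ((Paths.lift (adjoinedPrefunctor A a)).map f : A.obj i ⟶ A.obj j)
      (Hom.app ε i : (of A).Germ (A.obj i)) = Hom.app ε j := by
  induction f with
  | nil =>
    refine Eq.trans ?_ (Hom.map_app ε (𝟙 i))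
    exact congrArg (fun x => Germ.map x (Hom.app ε i)) (A.map_id i).symm
  | cons f e ih =>
    refine (Germ.map_map _ ((adjoinedPrefunctor A a).map e) _).symm.trans
      ((congrArg (Germ.map ((adjoinedPrefunctor A a).map e)) ih).trans ?_)
    exact map_adjoinedPrefunctor_app A a ε hε ha e

/-- The components of `ε` stay compatible along the adjoined arrows because `ε` is idempotent. This
gives both cofilteredness and the map from `A` to the enlarged diagram. -/
lemma map_diagram_app {i j : Adjoined A a} (f : i ⟶ j) :
    Germ.map ((diagram A a).map f) (Hom.app ε (val a i) : (of A).Germ (A.obj _)) =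
      Hom.app ε (val a j) := by
  induction f using Quot.ind with
  | mk f => exact map_path_app A a ε hε ha f

lemma isCofiltered : IsCofiltered (Adjoined A a) where
  nonempty := ⟨mk A a (Classical.choice IsCofiltered.nonempty)⟩
  cone_objs i j := ⟨mk A a (IsCofiltered.min (val a i) (val a j)),
    mkMap A a (IsCofiltered.minToLeft _ _), mkMap A a (IsCofiltered.minToRight _ _), trivial⟩
  cone_maps i j f g := by
    -- Parallel arrows `f`, `g` both send `ε_i`, the class of `a_i`, to `ε_j`. Hence they agree
    -- after `a_i` and some `p : r ⟶ t i`, so `p` followed by the adjoined arrow equalizes them.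
    have h := (map_diagram_app A a ε hε ha f).trans (map_diagram_app A a ε hε ha g).symm
    rw [← ha] at h
    obtain ⟨r, p, e⟩ := (Germ.mk_eq_mk_iff_of_same (of A) _ _).1 h
    refine ⟨mk A a r, mkMap A a p ≫ step A a _, diagram_map_injective A a ?_⟩
    have key (f : i ⟶ j) : (diagram A a).map ((mkMap A a p ≫ step A a _) ≫ f) =
        A.map p ≫ a (val a i) ≫ (diagram A a).map f :=
      ((diagram A a).map_comp _ f).trans
        ((congrArg (· ≫ (diagram A a).map f) (diagram_mkMap_step A a p)).trans
          (Category.assoc _ _ _))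
    exact (key f).trans (e.trans (key g).symm)

end Adjoined

/-- Idempotents split in pro-categories, without changing the objects that occur in the
diagrams. -/
theorem exists_splitting (A : I ⥤ D) [IsCofiltered I] (ε : of A ⟶ of A) (hε : ε ≫ ε = ε) :
    ∃ (J : Type w) (_ : SmallCategory J) (_ : IsCofiltered J) (H : J ⥤ D)
      (σ : of A ⟶ of H) (τ : of H ⟶ of A), σ ≫ τ = ε ∧ τ ≫ σ = 𝟙 _ ∧
        ∀ j, ∃ i, H.obj j = A.obj i := by
  choose t a ha using fun i : I => (Hom.app ε i).exists_rep
  have hJ := Adjoined.isCofiltered A a ε hε ha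
  let H := Adjoined.diagram A a
  let σ : of A ⟶ of H := Hom.mk (X := of A) (Y := of H)
    (fun j : Adjoined A a => Hom.app ε (Adjoined.val a j))
    (fun p => Adjoined.map_diagram_app A a ε hε ha p)
  let τ : of H ⟶ of A := Hom.mk (X := of H) (Y := of A)
    (fun i : I => Germ.mk (of H) (Adjoined.mk A a i) (𝟙 (A.obj i)))
    (fun {i j : I} p => by
      have h := Germ.mk_map_comp (of H) (Adjoined.mkMap A a p) (𝟙 (A.obj j))
      refine Eq.trans ?_ h
      refine congrArg (Germ.mk (of H) (Adjoined.mk A a i)) ?_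
      refine (Category.id_comp (A.map p)).trans ((Category.comp_id (A.map p)).symm.trans ?_)
      exact congrArg (· ≫ 𝟙 (A.obj j)) (Adjoined.diagram_mkMap A a p).symm)
  refine ⟨Adjoined A a, inferInstance, hJ, H, σ, τ, hom_ext fun i => ?_, hom_ext fun j => ?_,
    fun j => ⟨_, Adjoined.diagram_obj A a j⟩⟩
  · change Germ.map (𝟙 (A.obj i)) (Hom.app ε i) = Hom.app ε i
    rw [← ha i]
    exact congrArg (Germ.mk (of A) (t i)) (Category.comp_id _)
  · change Hom.bind τ (Hom.app ε (Adjoined.val a j)) = Germ.mk (of H) j (𝟙 (A.obj _))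
    rw [← ha (Adjoined.val a j)]
    -- Now `a_j` is a transition map of `H`, so its germ is that of the identity.
    refine Eq.trans ?_ (Germ.mk_map_comp (of H) (Adjoined.step A a (Adjoined.val a j)) (𝟙 _))
    refine congrArg (Germ.mk (of H) _) ?_
    refine (Category.id_comp (a _)).trans ((Category.comp_id (a _)).symm.trans ?_)
    exact congrArg (· ≫ 𝟙 (A.obj _)) (Adjoined.diagram_step A a _).symm

end Idempotent

/-! ### Level representations of retracts -/

section Retract

/-- Two splittings of the same idempotent are isomorphic. -/
def isoOfSplittings {E : Type*} [Category* E] {X Z H : E} {i : X ⟶ Z} {r : Z ⟶ X}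
    {σ : Z ⟶ H} {τ : H ⟶ Z} (hir : i ≫ r = 𝟙 X) (hτσ : τ ≫ σ = 𝟙 H)
    (h : σ ≫ τ = r ≫ i) : X ≅ H where
  hom := i ≫ σ
  inv := τ ≫ r
  hom_inv_id := by
    rw [Category.assoc, reassoc_of% h, hir, Category.comp_id, hir]
  inv_hom_id := by
    rw [Category.assoc, ← reassoc_of% h, hτσ, Category.comp_id, hτσ]

variable {C : Type u} [Category.{v} C]

lemma essentially_of_retract {P : MorphismProperty C} {I : Type w} [SmallCategory I]
    [IsCofiltered I] (A : I ⥤ Arrow C) (hA : ∀ i, P (A.obj i).hom)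
    {X Y : ProObj.{w} C} (f : X ⟶ Y)
    {iX : X ⟶ (mapFunctor Arrow.leftFunc).obj (of A)}
    {rX : (mapFunctor Arrow.leftFunc).obj (of A) ⟶ X}
    {iY : Y ⟶ (mapFunctor Arrow.rightFunc).obj (of A)}
    {rY : (mapFunctor Arrow.rightFunc).obj (of A) ⟶ Y}
    (hX : iX ≫ rX = 𝟙 X) (hY : iY ≫ rY = 𝟙 Y)
    (hi : iX ≫ (mapNatTrans Arrow.leftToRight).app (of A) = f ≫ iY)
    (hr : rX ≫ f = (mapNatTrans Arrow.leftToRight).app (of A) ≫ rY) :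
    essentially P f := by
  -- The retract data give idempotents at source and target that commute with the map, so fullness
  -- lifts them; faithfulness makes the lift idempotent.
  obtain ⟨ε, hl, hr'⟩ := exists_hom_arrow (rX ≫ iX) (rY ≫ iY)
    (by rw [Category.assoc, hi, reassoc_of% hr])
  have hε : ε ≫ ε = ε := by
    apply hom_arrow_ext
    · rw [Functor.map_comp, hl, Category.assoc, reassoc_of% hX]
    · rw [Functor.map_comp, hr', Category.assoc, reassoc_of% hY]
  obtain ⟨J, _, _, H, σ, τ, hστ, hτσ, hH⟩ := exists_splitting A ε hε
  have h_id (Φ : ProObj.{w} (Arrow C) ⥤ ProObj.{w} C) :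
      Φ.map τ ≫ Φ.map σ = 𝟙 (Φ.obj (of H)) := by
    rw [← Functor.map_comp, hτσ, Φ.map_id]
  have h_comp (Φ : ProObj.{w} (Arrow C) ⥤ ProObj.{w} C) : Φ.map σ ≫ Φ.map τ = Φ.map ε := by
    rw [← Functor.map_comp, hστ]
  refine ⟨{ Index := J
            source := H ⋙ Arrow.leftFunc
            target := H ⋙ Arrow.rightFunc
            η := Functor.whiskerLeft H Arrow.leftToRight
            isoSource := isoOfSplittings hX
              (h_id (mapFunctor Arrow.leftFunc)) ((h_comp _).trans hl)
            isoTarget := isoOfSplittings hY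
              (h_id (mapFunctor Arrow.rightFunc)) ((h_comp _).trans hr')
            comm := ?_ }, fun j => ?_⟩
  · change f ≫ iY ≫ _ = (iX ≫ _) ≫ (mapNatTrans Arrow.leftToRight).app (of H)
    rw [Category.assoc, (mapNatTrans Arrow.leftToRight).naturality, reassoc_of% hi]
  · obtain ⟨i, hi⟩ := hH j
    change P (H.obj j).hom
    rw [hi]
    exact hA i

/-- A natural transformation, as a diagram of arrows. -/
def arrowDiagram {I : Type w} [SmallCategory I] {F G : I ⥤ C} (η : F ⟶ G) : I ⥤ Arrow C where
  obj i := Arrow.mk (η.app i)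
  map p := Arrow.homMk (F.map p) (G.map p) (by simp)

end Retract

end ProObj

open ProObj in
theorem corollary5p6 {C : Type u} [Category.{v} C] (P : MorphismProperty C) :
    (ProObj.essentially.{w} P).IsStableUnderRetracts := by
  refine ⟨fun {X Y Z W f g} h ⟨R, hR⟩ => ?_⟩
  have hη : R.isoSource.inv ≫ g = levelMap R.η ≫ R.isoTarget.inv := by
    rw [Iso.inv_comp_eq, ← Category.assoc, Iso.eq_comp_inv, R.comm]
  have hX : (h.i.left ≫ R.isoSource.hom) ≫ R.isoSource.inv ≫ h.r.left = 𝟙 X := by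
    rw [Category.assoc, Iso.hom_inv_id_assoc]
    exact h.retract_left
  have hY : (h.i.right ≫ R.isoTarget.hom) ≫ R.isoTarget.inv ≫ h.r.right = 𝟙 Y := by
    rw [Category.assoc, Iso.hom_inv_id_assoc]
    exact h.retract_right
  have hi : (h.i.left ≫ R.isoSource.hom) ≫ levelMap R.η =
      f ≫ h.i.right ≫ R.isoTarget.hom := by
    rw [Category.assoc, ← R.comm]
    exact h.i_w_assoc _
  have hr : (R.isoSource.inv ≫ h.r.left) ≫ f =
      levelMap R.η ≫ R.isoTarget.inv ≫ h.r.right := by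
    rw [← reassoc_of% hη, Category.assoc]
    exact congrArg (R.isoSource.inv ≫ ·) h.r_w
  exact essentially_of_retract (arrowDiagram R.η) hR f hX hY hi hr
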